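/- Let $\sigma:\mathbb R\to\mathbb R$ be a $C^\infty$ rectified activation function: $\sigma(t)=0$ for $t\le 0$ and $\sigma$ is strictly increasing on $(0,\infty)$. Consider fully connected feedforward networks with input dimension $p$, $T\ge 1$ hidden layers of widths $h_1,\dots,h_T\ge 1$, and one real output, i.e. the functions $$f_{w,b}(x)=M_{T+1}\,\sigma\bigl(M_T\,\sigma(\cdots\sigma(M_1x-b_1)\cdots)-b_T\bigr)-b_{T+1},$$ where $\sigma$ is applied componentwise, $M_j$ is a real $h_j\times h_{j-1}$ matrix and $b_j\in\mathbb R^{h_j}$ (with $h_0=p$, $h_{T+1}=1$). The parameters $(w,b)$ are all the entries of the $M_j$ and $b_j$; they range freely over $\mathbb R^n$, $n=\sum_{j=1}^{T+1}(h_jh_{j-1}+h_j)$. Let $x_1,\dots,x_d\in\mathbb R^p$ be distinct, let $y\in\mathbb R^d$, and suppose that the last hidden layer has width $h_T>d$ (so $n>d$). Then for every $\varepsilon>0$ there is $y'\in\mathbb R^d$ with $|y'-y|<\varepsilon$ such that, for the data set $\{(x_i,y'_i)\}_{i=1}^d$ and the squared loss $$L(w,b)=\sum_{i=1}^d\bigl(f_{w,b}(x_i)-y'_i\bigr)^2,$$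 the global minimum of $L$ over $\mathbb R^n$ is attained and equal to $0$, and the set of global minima $M=L^{-1}(0)$ is a nonempty smooth (embedded, $C^\infty$) $(n-d)$-dimensional submanifold of $\mathbb R^n$. -/

import Mathlib

open scoped ContDiff

/-- A continuous activation function that vanishes on `(-∞, 0]` and is (strictly) increasing
on `(0, ∞)`. -/
structure IsRectified (σ : ℝ → ℝ) : Prop where
  continuous : Continuous σ
  eq_zero : ∀ x ≤ 0, σ x = 0
  strictMonoOn : StrictMonoOn σ (Set.Ioi 0)

/-- Index type of the parameters (weights and biases) of the fully connected feedforward network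
with `m` inputs, hidden layers whose widths are listed in order, and one output.
A layer from `m` to `k` nodes has the weights `Fin k × Fin m` and the biases `Fin k`;
the output layer has the weights `Fin m` and a single bias. -/
def ParamIdx : ℕ → List ℕ → Type
  | m, [] => Fin m ⊕ Unit
  | m, k :: hs => ((Fin k × Fin m) ⊕ Fin k) ⊕ ParamIdx k hs

instance instFintypeParamIdx : (m : ℕ) → (hs : List ℕ) → Fintype (ParamIdx m hs)
  | m, [] => inferInstanceAs (Fintype (Fin m ⊕ Unit))
  | m, k :: hs =>
    letI := instFintypeParamIdx k hs
    inferInstanceAs (Fintype (((Fin k × Fin m) ⊕ Fin k) ⊕ ParamIdx k hs))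

/-- The function computed by the feedforward network with parameters `θ`: a hidden layer maps
`x` to `σ (W x - b)` with `σ` applied componentwise, and the output layer maps `x` to `w ⬝ x - b`
without a nonlinearity. -/
def network (σ : ℝ → ℝ) :
    (m : ℕ) → (hs : List ℕ) → (ParamIdx m hs → ℝ) → (Fin m → ℝ) → ℝ
  | m, [], θ, x => (∑ j : Fin m, θ (Sum.inl j) * x j) - θ (Sum.inr ())
  | m, k :: hs, θ, x =>
    network σ k hs (fun i => θ (Sum.inr i))
      (fun i : Fin k =>
        σ ((∑ j : Fin m, θ (Sum.inl (Sum.inl (i, j))) * x j) - θ (Sum.inl (Sum.inr i))))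

/-- The number `n` of parameters. -/
def numParams (m : ℕ) (hs : List ℕ) : ℕ := Fintype.card (ParamIdx m hs)

/-- The squared loss `L(θ) = ∑ i, (f_θ(x i) - y i) ^ 2` on the data set `(x i, y i)`. -/
noncomputable def loss (σ : ℝ → ℝ) {p d : ℕ} (hs : List ℕ)
    (x : Fin d → EuclideanSpace ℝ (Fin p)) (y : EuclideanSpace ℝ (Fin d))
    (θ : EuclideanSpace ℝ (ParamIdx p hs)) : ℝ :=
  ∑ i : Fin d, (network σ p hs (fun a => θ a) (fun j => x i j) - y i) ^ 2

/-- `M` is a smooth embedded `k`-dimensional submanifold of `ℝ^ι` (possibly empty): around each of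
its points there is a smooth chart of `ℝ^ι`, with smooth inverse, which takes `M` to the slice on
which all coordinates after the first `k` vanish. -/
def IsSmoothSubmanifold {ι : Type*} [Fintype ι] (k : ℕ) (M : Set (EuclideanSpace ℝ ι)) : Prop :=
  k ≤ Fintype.card ι ∧
  ∀ q ∈ M, ∃ φ : OpenPartialHomeomorph (EuclideanSpace ℝ ι)
      (EuclideanSpace ℝ (Fin (Fintype.card ι))),
    q ∈ φ.source ∧
    ContDiffOn ℝ ∞ φ φ.source ∧
    ContDiffOn ℝ ∞ φ.symm φ.target ∧
    ∀ z ∈ φ.source, z ∈ M ↔ ∀ i : Fin (Fintype.card ι), k ≤ (i : ℕ) → φ z i = 0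

/-!
The outputs of the network on the `d` data points form a smooth map `f` from the parameter space
`ℝ^n` to `ℝ^d`, and the loss for the labels `y'` is `‖f θ - y'‖ ^ 2`.

*The loss attains the value zero for all labels* (`IsRectified.exists_network_eq`). A generic linear
functional separates the data points; since `σ` is injective on `(0, ∞)`, the hidden layers before
the last one can pass this separating scalar on. In the last hidden layer, neuron `j` gets a
threshold just below the `j`-th scalar, and the resulting matrix of outputs is triangular with
positive diagonal, so the output weights can be chosen to fit the labels.

*The zero set is a submanifold for generic labels.* If `y'` is a regular value of `f`, then
`f ⁻¹' {y'}` is a submanifold of codimension `d` (`isSmoothSubmanifold_preimage_of_regular`).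
Regular values are dense by Sard's theorem, proved here in the form that the critical values of a
smooth map are meagre (`ContDiff.isMeagre_criticalValues`).

The proof of Sard's theorem first treats the points where the whole differential vanishes and
shows that their image has Hausdorff dimension zero (`dimH_image_fderiv_eq_zero`). Where all
derivatives vanish, Taylor's estimate makes the map Hölder of every exponent on the set of such
points. The other points lie on countably many smooth hypersurfaces, zero sets of higher
derivatives, which gives an induction on the dimension. Near a point where the differential has
rank `r`, the map takes the form `(t, k) ↦ (t, h (t, k))` with `t` in an `r`-dimensional space, and
the points of rank `r` are those where the differential of `h (t, ·)` vanishes. So the image of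
the rank-`r` points near the given one lies in a compact set whose slices have dimension zero and
hence empty interior; this compact set is nowhere dense, and countably many such sets cover the
critical values.
-/

open Set Filter Topology Module

/-! ### Adapted local coordinates -/

section Coordinates

variable {E F G : Type*} [NormedAddCommGroup E] [NormedSpace ℝ E]
  [NormedAddCommGroup F] [NormedSpace ℝ F] [NormedAddCommGroup G] [NormedSpace ℝ G]

/-- Inverse function theorem with a smooth inverse on the whole target: the source is shrunk to
the open set on which the derivative is invertible. -/
theorem ContDiffOn.exists_openPartialHomeomorph [CompleteSpace E] {f : E → G} {U : Set E}
    (hU : IsOpen U) (hf : ContDiffOn ℝ ∞ f U) {q : E} (hq : q ∈ U) (e : E ≃L[ℝ] G)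
    (he : HasFDerivAt f (e : E →L[ℝ] G) q) :
    ∃ Φ : OpenPartialHomeomorph E G, q ∈ Φ.source ∧ Φ.source ⊆ U ∧ (∀ z, Φ z = f z) ∧
      ContDiffOn ℝ ∞ Φ.symm Φ.target := by
  have hc : ContDiffAt ℝ ∞ f q := hf.contDiffAt (hU.mem_nhds hq)
  set V : Set E := U ∩ fderiv ℝ f ⁻¹' range ((↑) : (E ≃L[ℝ] G) → E →L[ℝ] G) with hV
  have hVo : IsOpen V :=
    (hf.continuousOn_fderiv_of_isOpen hU (by simp)).isOpen_inter_preimage hU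
      ContinuousLinearEquiv.isOpen
  set Ψ := hc.toOpenPartialHomeomorph f he (by simp) with hΨ
  have hΨf : ∀ z, Ψ z = f z := fun z => rfl
  refine ⟨Ψ.restrOpen V hVo, ⟨hc.mem_toOpenPartialHomeomorph_source he (by simp), hq, e,
    he.fderiv.symm⟩, fun z hz => hz.2.1, hΨf, ?_⟩
  intro y hy
  set z := (Ψ.restrOpen V hVo).symm y with hz
  have hzV : z ∈ V := ((Ψ.restrOpen V hVo).map_target hy).2
  obtain ⟨e', he'⟩ := hzV.2
  have hcz : ContDiffAt ℝ ∞ f z := hf.contDiffAt (hU.mem_nhds hzV.1)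
  refine ((Ψ.restrOpen V hVo).contDiffAt_symm hy (f₀' := e') ?_ hcz).contDiffWithinAt
  rw [he']
  exact (hcz.differentiableAt (by simp)).hasFDerivAt

/-- A surjective continuous linear map and a projection onto its kernel are jointly a linear
isomorphism. -/
theorem ContinuousLinearMap.exists_equiv_prod_ker [FiniteDimensional ℝ E] [FiniteDimensional ℝ G]
    (L : E →L[ℝ] G) (hL : Function.Surjective L) :
    ∃ (P : E →L[ℝ] L.ker) (e : E ≃L[ℝ] G × L.ker), ∀ v, e v = (L v, P v) := by
  have : CompleteSpace E := FiniteDimensional.complete ℝ E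
  have : CompleteSpace G := FiniteDimensional.complete ℝ G
  obtain ⟨P, hP⟩ := L.ker_closedComplemented_of_finiteDimensional_range
  have hc : IsCompl L.ker P.ker := LinearMap.isCompl_of_proj (f := (P : E →ₗ[ℝ] L.ker)) hP
  refine ⟨P, ContinuousLinearMap.equivProdOfSurjectiveOfIsCompl L P
    (LinearMap.range_eq_top.2 hL) (LinearMap.range_eq_top.2 fun y => ⟨y, hP y⟩) hc, fun v => rfl⟩

/-- Near a point where its derivative is surjective, a smooth map `f` is the first component of a
smooth chart. -/
theorem ContDiffOn.exists_submersion_chart [FiniteDimensional ℝ E] [FiniteDimensional ℝ G]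
    {f : E → G} {U : Set E} (hU : IsOpen U) (hf : ContDiffOn ℝ ∞ f U) {q : E} (hq : q ∈ U)
    (hs : Function.Surjective (fderiv ℝ f q)) :
    ∃ (P : E →L[ℝ] (fderiv ℝ f q).ker)
      (Φ : OpenPartialHomeomorph E (G × (fderiv ℝ f q).ker)),
      q ∈ Φ.source ∧ Φ.source ⊆ U ∧ (∀ z, Φ z = (f z, P z)) ∧
      ContDiffOn ℝ ∞ Φ.symm Φ.target := by
  have : CompleteSpace E := FiniteDimensional.complete ℝ E
  obtain ⟨P, e, he⟩ := (fderiv ℝ f q).exists_equiv_prod_ker hs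
  refine ⟨P, ?_⟩
  refine ContDiffOn.exists_openPartialHomeomorph (f := fun z => (f z, P z)) hU
    (hf.prodMk P.contDiff.contDiffOn) hq e ?_
  have h1 : HasFDerivAt f (fderiv ℝ f q) q :=
    ((hf.contDiffAt (hU.mem_nhds hq)).differentiableAt (by simp)).hasFDerivAt
  have heq : (e : E →L[ℝ] G × (fderiv ℝ f q).ker) = (fderiv ℝ f q).prod P :=
    ContinuousLinearMap.ext he
  rw [heq]
  exact h1.prodMk P.hasFDerivAt

end Coordinates

/-! ### Images of degenerate critical points -/

section Degenerate

universe u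

/-- On a compact convex set, a smooth function varies from a point at which all its derivatives
vanish by at most a constant times any given power of the distance, uniformly in that point. -/
theorem exists_norm_sub_le_pow_of_flat {E : Type u} [NormedAddCommGroup E] [NormedSpace ℝ E]
    {U K : Set E} (hU : IsOpen U) (hKU : K ⊆ U) (hK : IsCompact K) (hKc : Convex ℝ K) (N : ℕ) :
    ∀ {F : Type u} [NormedAddCommGroup F] [NormedSpace ℝ F] {f : E → F}, ContDiffOn ℝ ∞ f U →
      ∃ C : ℝ, 0 ≤ C ∧ ∀ x ∈ K, (∀ j, 0 < j → iteratedFDeriv ℝ j f x = 0) →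
        ∀ y ∈ K, ‖f y - f x‖ ≤ C * ‖y - x‖ ^ N := by
  induction N with
  | zero =>
    intro F _ _ f hf
    obtain ⟨C, hC⟩ := hK.exists_bound_of_continuousOn (hf.continuousOn.mono hKU)
    refine ⟨max C 0 + max C 0, by positivity, fun x hx _ y hy => ?_⟩
    rw [pow_zero, mul_one]
    exact (norm_sub_le _ _).trans (add_le_add ((hC y hy).trans (le_max_left _ _))
      ((hC x hx).trans (le_max_left _ _)))
  | succ N ih =>
    intro F _ _ f hf
    obtain ⟨C, hC0, hC⟩ := ih (hf.fderiv_of_isOpen hU (m := ∞) (by simp))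
    refine ⟨C, hC0, fun x hx hflat y hy => ?_⟩
    have hflat' : ∀ j, iteratedFDeriv ℝ j (fderiv ℝ f) x = 0 := fun j => by
      rw [← norm_eq_zero, norm_iteratedFDeriv_fderiv, hflat _ j.succ_pos, norm_zero]
    have h0 : fderiv ℝ f x = 0 := by
      have := hflat' 0
      rwa [← norm_eq_zero, norm_iteratedFDeriv_zero, norm_eq_zero] at this
    have hseg : segment ℝ x y ⊆ K := hKc.segment_subset hx hy
    have := (convex_segment x y).norm_image_sub_le_of_norm_fderiv_le (𝕜 := ℝ) (f := f)
      (C := C * ‖y - x‖ ^ N)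
      (fun z hz => (hf.contDiffAt (hU.mem_nhds (hKU (hseg hz)))).differentiableAt (by simp))
      (fun z hz => by
        have h1 := hC x hx (fun j _ => hflat' j) z (hseg hz)
        rw [h0, sub_zero] at h1
        refine h1.trans ?_
        gcongr
        exact norm_sub_le_of_mem_segment hz)
      (left_mem_segment ℝ x y) (right_mem_segment ℝ x y)
    rwa [mul_assoc, ← pow_succ] at this

variable {E : Type u} [NormedAddCommGroup E] [NormedSpace ℝ E] [FiniteDimensional ℝ E]
  {F : Type u} [NormedAddCommGroup F] [NormedSpace ℝ F]

/-- The map is Hölder of every exponent `N` on the set of points where it is flat, so the image has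
dimension at most `dim E / N` for all `N`. -/
theorem dimH_image_flat_eq_zero {U : Set E} (hU : IsOpen U) {f : E → F} (hf : ContDiffOn ℝ ∞ f U) :
    dimH (f '' {x ∈ U | ∀ j, 0 < j → iteratedFDeriv ℝ j f x = 0}) = 0 := by
  set A := {x ∈ U | ∀ j, 0 < j → iteratedFDeriv ℝ j f x = 0} with hA
  have key : ∀ N : ℕ, 0 < N → dimH (f '' A) ≤ dimH A / ((N : NNReal) : ENNReal) := by
    intro N hN
    refine dimH_image_le_of_locally_holder_on (by exact_mod_cast hN) fun x hx => ?_
    obtain ⟨r, hr, hrU⟩ := Metric.nhds_basis_closedBall.mem_iff.1 (hU.mem_nhds hx.1)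
    obtain ⟨C, hC0, hC⟩ := exists_norm_sub_le_pow_of_flat hU hrU (isCompact_closedBall x r)
      (convex_closedBall x r) N hf
    refine ⟨C.toNNReal, A ∩ Metric.closedBall x r, inter_mem_nhdsWithin _
      (Metric.closedBall_mem_nhds x hr), fun y hy z hz => ?_⟩
    have h1 := hC z hz.2 hz.1.2 y hy.2
    rw [edist_dist, edist_dist, dist_eq_norm, dist_eq_norm, NNReal.coe_natCast, ENNReal.rpow_natCast,
      ← ENNReal.ofReal_pow (norm_nonneg _), ← ENNReal.ofReal,
      ← ENNReal.ofReal_mul hC0]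
    exact ENNReal.ofReal_le_ofReal h1
  have htop : dimH A ≠ ⊤ := Real.dimH_ne_top A
  have hlim : Tendsto (fun N : ℕ => dimH A / ((N : NNReal) : ENNReal)) atTop (𝓝 0) := by
    simp only [ENNReal.coe_natCast]
    exact ENNReal.Tendsto.const_div ENNReal.tendsto_nat_nhds_top (Or.inr htop) |>.trans (by simp)
  exact le_antisymm (ge_of_tendsto hlim ((eventually_gt_atTop 0).mono key)) bot_le

theorem dimH_image_eq_zero_of_locally {X Y : Type*} [EMetricSpace X]
    [SecondCountableTopology X] [EMetricSpace Y] {f : X → Y} {s : Set X}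
    (h : ∀ x ∈ s, ∃ t ∈ 𝓝 x, dimH (f '' (s ∩ t)) = 0) : dimH (f '' s) = 0 := by
  choose! t ht h0 using h
  obtain ⟨c, hcs, hc, hsc⟩ := TopologicalSpace.countable_cover_nhdsWithin
    (f := t) fun x hx => nhdsWithin_le_nhds (ht x hx)
  have : f '' s ⊆ ⋃ x ∈ c, f '' (s ∩ t x) := by
    rw [← image_iUnion₂, ← inter_iUnion₂]
    exact image_mono (subset_inter Subset.rfl hsc)
  refine le_antisymm ((dimH_mono this).trans ?_) bot_le
  rw [dimH_bUnion hc]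
  exact iSup₂_le fun x hx => (h0 x (hcs hx)).le

/-- The points where the differential of a smooth map vanishes have an image of dimension zero.
By induction on the dimension of the source: such a point is either flat, or some higher derivative
vanishes there while its differential does not. Near a point of the second kind, the points of the
same kind lie on a smooth hypersurface, and the differential of the restriction of the map to this
hypersurface vanishes at them. -/
theorem dimH_image_fderiv_eq_zero (n : ℕ) :
    ∀ {E : Type u} [NormedAddCommGroup E] [NormedSpace ℝ E] [FiniteDimensional ℝ E],
      finrank ℝ E = n → ∀ {U : Set E}, IsOpen U → ∀ {f : E → F}, ContDiffOn ℝ ∞ f U →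
        dimH (f '' {x ∈ U | fderiv ℝ f x = 0}) = 0 := by
  induction n with
  | zero =>
    intro E _ _ _ hE U hU f hf
    have : Subsingleton E := finrank_zero_iff.1 hE
    exact (subsingleton_of_subsingleton.image f).dimH_zero
  | succ n ih =>
    intro E _ _ _ hE U hU f hf
    set B : ℕ → Set E := fun i => {x ∈ U | fderiv ℝ f x = 0 ∧ iteratedFDeriv ℝ i f x = 0 ∧
      iteratedFDeriv ℝ (i + 1) f x ≠ 0} with hB
    have hcover : {x ∈ U | fderiv ℝ f x = 0} ⊆
        {x ∈ U | ∀ j, 0 < j → iteratedFDeriv ℝ j f x = 0} ∪ ⋃ i, B i := by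
      classical
      rintro x ⟨hxU, hx⟩
      by_cases hfl : ∀ j, 0 < j → iteratedFDeriv ℝ j f x = 0
      · exact Or.inl ⟨hxU, hfl⟩
      · push Not at hfl
        right
        obtain ⟨hj0, hj⟩ := Nat.find_spec hfl
        have hmin := fun {m} => Nat.find_min hfl (m := m)
        set j := Nat.find hfl
        have h1 : iteratedFDeriv ℝ 1 f x = 0 := by
          rw [← norm_eq_zero, ← zero_add 1, ← norm_iteratedFDeriv_fderiv, norm_iteratedFDeriv_zero, hx,
            norm_zero]
        have hj1 : j ≠ 1 := fun h => hj (h ▸ h1)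
        refine mem_iUnion.2 ⟨j - 1, hxU, hx, ?_, ?_⟩
        · have := hmin (m := j - 1) (by omega)
          by_contra hne
          exact this ⟨by omega, hne⟩
        · rwa [Nat.sub_add_cancel hj0]
    have hBi : ∀ i, dimH (f '' B i) = 0 := by
      intro i
      refine dimH_image_eq_zero_of_locally fun q hq => ?_
      obtain ⟨hqU, hq1, hq2, hq3⟩ := hq
      -- a scalar component `w` of the `i`-th derivative with nonzero differential at `q`
      set u := iteratedFDeriv ℝ i f with hu
      have huU : ContDiffOn ℝ ∞ u U := fun z hz =>
        ((hf.contDiffAt (hU.mem_nhds hz)).iteratedFDeriv_right (m := ∞) (by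
          exact_mod_cast le_top)).contDiffWithinAt
      have hdu : fderiv ℝ u q ≠ 0 := fun h0 => hq3 (by
        rw [← norm_eq_zero, ← norm_fderiv_iteratedFDeriv, ← hu, h0]
        exact norm_zero (E := E →L[ℝ] ContinuousMultilinearMap ℝ (fun _ : Fin i => E) F))
      obtain ⟨v, hv⟩ := DFunLike.ne_iff.1 hdu
      obtain ⟨l, hl⟩ := SeparatingDual.exists_ne_zero (R := ℝ) hv
      set w : E → ℝ := fun z => l (u z) with hw
      have hwU : ContDiffOn ℝ ∞ w U := l.contDiff.comp_contDiffOn huU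
      have hdw : fderiv ℝ w q v ≠ 0 := by
        have := (l.hasFDerivAt.comp q ((huU.contDiffAt (hU.mem_nhds hqU)).differentiableAt
          (by simp)).hasFDerivAt).fderiv
        rw [show fderiv ℝ w q = _ from this]
        exact hl
      have hsurj : Function.Surjective (fderiv ℝ w q) :=
        LinearMap.surjective (f := ((fderiv ℝ w q : E →L[ℝ] ℝ) : E →ₗ[ℝ] ℝ))
          (fun h0 => hdw (LinearMap.congr_fun h0 v))
      obtain ⟨P, Φ, hqΦ, hΦU, hΦ, hΦs⟩ := hwU.exists_submersion_chart hU hqU hsurj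
      have hdim : finrank ℝ (fderiv ℝ w q).ker = n := by
        have := LinearMap.finrank_range_add_finrank_ker ((fderiv ℝ w q : E →L[ℝ] ℝ) : E →ₗ[ℝ] ℝ)
        rw [LinearMap.range_eq_top.2 hsurj, finrank_top, finrank_self, hE] at this
        omega
      -- the hypersurface `w = 0` is parametrized by the kernel of `dw`
      set ψ : (fderiv ℝ w q).ker → E := fun k => Φ.symm (0, k) with hψ
      set V : Set (fderiv ℝ w q).ker := (fun k => ((0 : ℝ), k)) ⁻¹' Φ.target with hV
      have hVo : IsOpen V := Φ.open_target.preimage (by fun_prop)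
      have hψV : ContDiffOn ℝ ∞ ψ V :=
        hΦs.comp (contDiff_const.prodMk contDiff_id).contDiffOn (fun k hk => hk)
      have hmaps : MapsTo ψ V U := fun k hk => hΦU (Φ.map_target hk)
      refine ⟨Φ.source, Φ.open_source.mem_nhds hqΦ, le_antisymm ?_ bot_le⟩
      refine (dimH_mono ?_).trans
        (ih hdim hVo (f := f ∘ ψ) (hf.comp hψV hmaps)).le
      rintro _ ⟨z, ⟨⟨hzU, hz1, hz2, -⟩, hzΦ⟩, rfl⟩
      have hwz : w z = 0 := by
        change l (iteratedFDeriv ℝ i f z) = 0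
        rw [hz2, map_zero]
      have hzk : Φ z = (0, P z) := by rw [hΦ, hwz]
      have hψz : ψ (P z) = z := by
        rw [hψ]
        simp only
        rw [← hzk, Φ.left_inv hzΦ]
      have hPV : P z ∈ V := by
        rw [hV, mem_preimage, ← hzk]
        exact Φ.map_source hzΦ
      refine ⟨P z, ⟨hPV, ?_⟩, congrArg f hψz⟩
      have h1 : HasFDerivAt f (0 : E →L[ℝ] F) (ψ (P z)) := by
        rw [hψz, ← hz1]
        exact ((hf.contDiffAt (hU.mem_nhds hzU)).differentiableAt (by simp)).hasFDerivAt
      have h2 := ((hψV.contDiffAt (hVo.mem_nhds hPV)).differentiableAt (by simp)).hasFDerivAt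
      rw [(h1.comp _ h2).fderiv, ContinuousLinearMap.zero_comp]
    refine le_antisymm ((dimH_mono (image_mono hcover)).trans ?_) bot_le
    rw [image_union, image_iUnion, dimH_union, dimH_iUnion, dimH_image_flat_eq_zero hU hf]
    simp [hBi]

end Degenerate

/-! ### Critical values are meagre -/

section Sard

/-- If composing `A` with `B` does not lower the rank, it does not enlarge the kernel. -/
theorem LinearMap.ker_comp_eq_of_surjective_of_finrank_range_eq {E F V : Type*}
    [AddCommGroup E] [Module ℝ E] [FiniteDimensional ℝ E] [AddCommGroup F] [Module ℝ F]
    [AddCommGroup V] [Module ℝ V] (A : E →ₗ[ℝ] F) (B : F →ₗ[ℝ] V)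
    (hs : Function.Surjective (B ∘ₗ A)) (hr : finrank ℝ A.range = finrank ℝ V) :
    (B ∘ₗ A).ker = A.ker := by
  refine (Submodule.eq_of_le_of_finrank_eq (LinearMap.ker_le_ker_comp A B) ?_).symm
  have h1 := A.finrank_range_add_finrank_ker
  have h2 := (B ∘ₗ A).finrank_range_add_finrank_ker
  rw [LinearMap.range_eq_top.2 hs, finrank_top] at h2
  omega

universe u

variable {E F : Type u} [NormedAddCommGroup E] [NormedSpace ℝ E] [FiniteDimensional ℝ E]
  [NormedAddCommGroup F] [NormedSpace ℝ F] [FiniteDimensional ℝ F]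

/-- For a smooth family of maps `k ↦ h (t, k)`, the set of pairs of a parameter `t` and a value of
`h (t, ·)` at a point where its differential vanishes is nowhere dense, the points being restricted
to a compact set: it is compact, and its slices have dimension zero. -/
theorem isNowhereDense_degenerate_values {V K W : Type u}
    [NormedAddCommGroup V] [NormedSpace ℝ V]
    [NormedAddCommGroup K] [NormedSpace ℝ K] [FiniteDimensional ℝ K]
    [NormedAddCommGroup W] [NormedSpace ℝ W] [FiniteDimensional ℝ W] [Nontrivial W]
    {T : Set (V × K)} (hT : IsOpen T) {h : V × K → W} (hh : ContDiffOn ℝ ∞ h T)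
    {Q : Set (V × K)} (hQ : IsCompact Q) (hQT : Q ⊆ T) :
    IsClosed ((fun p => (p.1, h p)) ''
        {p ∈ Q | (fderiv ℝ h p).comp (ContinuousLinearMap.inr ℝ V K) = 0}) ∧
    IsNowhereDense ((fun p => (p.1, h p)) ''
        {p ∈ Q | (fderiv ℝ h p).comp (ContinuousLinearMap.inr ℝ V K) = 0}) := by
  set D := {p ∈ Q | (fderiv ℝ h p).comp (ContinuousLinearMap.inr ℝ V K) = 0} with hD
  have hdc : ContinuousOn (fun p => (fderiv ℝ h p).comp (ContinuousLinearMap.inr ℝ V K)) Q :=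
    ((hh.continuousOn_fderiv_of_isOpen hT (by simp)).mono hQT).clm_comp continuousOn_const
  have hDc : IsCompact D := hQ.of_isClosed_subset
    (hdc.preimage_isClosed_of_isClosed hQ.isClosed isClosed_singleton) (fun p hp => hp.1)
  have hS : IsClosed ((fun p => (p.1, h p)) '' D) := by
    refine (hDc.image_of_continuousOn ?_).isClosed
    exact continuousOn_fst.prodMk (hh.continuousOn.mono fun p hp => hQT hp.1)
  refine ⟨hS, hS.isNowhereDense_iff.2 (eq_empty_iff_forall_notMem.2 ?_)⟩
  rintro ⟨t, w⟩ htw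
  have hslice : {w' | (t, w') ∈ (fun p => (p.1, h p)) '' D} ∈ 𝓝 w :=
    (Continuous.continuousAt (f := fun w' : W => (t, w')) (by fun_prop)).preimage_mem_nhds
      (mem_interior_iff_mem_nhds.1 htw)
  have hdim := Real.dimH_of_mem_nhds hslice
  set Vt : Set K := (fun k => (t, k)) ⁻¹' T with hVt
  have hVto : IsOpen Vt := hT.preimage (by fun_prop)
  have hg : ContDiffOn ℝ ∞ (fun k => h (t, k)) Vt :=
    hh.comp (contDiff_const.prodMk contDiff_id).contDiffOn (fun k hk => hk)
  have hzero := dimH_image_fderiv_eq_zero (finrank ℝ K) rfl hVto hg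
  have hsub : {w' | (t, w') ∈ (fun p => (p.1, h p)) '' D} ⊆
      (fun k => h (t, k)) '' {k ∈ Vt | fderiv ℝ (fun k => h (t, k)) k = 0} := by
    rintro w' ⟨⟨t', k⟩, ⟨hpQ, hp⟩, heq⟩
    obtain ⟨rfl, rfl⟩ := Prod.mk.inj heq
    refine ⟨k, ⟨hQT hpQ, ?_⟩, rfl⟩
    have h1 : HasFDerivAt h (fderiv ℝ h (t', k)) (t', k) :=
      ((hh.contDiffAt (hT.mem_nhds (hQT hpQ))).differentiableAt (by simp)).hasFDerivAt
    exact (h1.comp k (hasFDerivAt_prodMk_right t' k)).fderiv.trans hp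
  have h0 := (dimH_mono hsub).trans_eq hzero
  rw [hdim] at h0
  have : finrank ℝ W = 0 := by simpa using h0
  exact finrank_pos.ne' this

/-- Near a critical point `q`, the points at which `f` has the same rank as at `q` are mapped to a
nowhere dense set: in a chart of `E` and a splitting of `F`, the map is `(t, k) ↦ (t, h (t, k))`,
and the rank condition says that the differential of `k ↦ h (t, k)` vanishes. -/
theorem ContDiff.exists_nhds_isNowhereDense_image_rank_eq {f : E → F} (hf : ContDiff ℝ ∞ f) {q : E}
    (hq : ¬ Function.Surjective (fderiv ℝ f q)) :
    ∃ t ∈ 𝓝 q, IsNowhereDense (f '' {z ∈ t |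
      finrank ℝ (fderiv ℝ f z).range = finrank ℝ (fderiv ℝ f q).range}) := by
  set L := fderiv ℝ f q with hL
  set V : Submodule ℝ F := (L : E →ₗ[ℝ] F).range with hV
  obtain ⟨W, e, he, -, -⟩ := Submodule.ClosedComplemented.exists_submodule_equiv_prod
    (Submodule.ClosedComplemented.of_finiteDimensional V)
  have hWnt : Nontrivial W := by
    by_contra hW
    rw [not_nontrivial_iff_subsingleton] at hW
    refine hq fun y => ?_
    have hy : e y = e ((e y).1 : F) := by rw [he]; exact Prod.ext rfl (Subsingleton.elim _ _)
    obtain ⟨x, hx⟩ := (e y).1.2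
    exact ⟨x, by rw [e.injective hy]; exact hx⟩
  -- `π` and `ρ` are the components of `F ≃ V × W`, where `V` is the range of the differential
  set π : F →L[ℝ] V := (ContinuousLinearMap.fst ℝ V W).comp (e : F →L[ℝ] V × W) with hπ
  set ρ : F →L[ℝ] W := (ContinuousLinearMap.snd ℝ V W).comp (e : F →L[ℝ] V × W) with hρ
  have hf1 : ∀ z, HasFDerivAt (fun z => π (f z)) (π.comp (fderiv ℝ f z)) z := fun z =>
    π.hasFDerivAt.comp z (hf.differentiable (by simp) z).hasFDerivAt
  have hf2 : ∀ z, HasFDerivAt (fun z => ρ (f z)) (ρ.comp (fderiv ℝ f z)) z := fun z =>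
    ρ.hasFDerivAt.comp z (hf.differentiable (by simp) z).hasFDerivAt
  have hsurj : Function.Surjective (fderiv ℝ (fun z => π (f z)) q) := by
    rw [(hf1 q).fderiv]
    rintro ⟨_, x, rfl⟩
    refine ⟨x, ?_⟩
    change (e (L x)).1 = _
    exact congrArg Prod.fst (he ⟨L x, x, rfl⟩)
  obtain ⟨K, P, Φ, hqΦ, hΦ, hΦs⟩ : ∃ (K : Submodule ℝ E) (P : E →L[ℝ] K)
      (Φ : OpenPartialHomeomorph E (V × K)), q ∈ Φ.source ∧ (∀ z, Φ z = (π (f z), P z)) ∧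
      ContDiffOn ℝ ∞ Φ.symm Φ.target := by
    obtain ⟨P, Φ, hqΦ, -, hΦ, hΦs⟩ := ContDiffOn.exists_submersion_chart
      (f := fun z => π (f z)) isOpen_univ (π.contDiff.comp hf).contDiffOn (mem_univ q) hsurj
    exact ⟨_, P, Φ, hqΦ, hΦ, hΦs⟩
  set h : V × K → W := fun p => ρ (f (Φ.symm p)) with hh
  have hhs : ContDiffOn ℝ ∞ h Φ.target := (ρ.contDiff.comp hf).comp_contDiffOn hΦs
  have : ProperSpace (V × K) := FiniteDimensional.proper ℝ _
  obtain ⟨r, hr, hrT⟩ := Metric.nhds_basis_closedBall.mem_iff.1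
    (Φ.open_target.mem_nhds (Φ.map_source hqΦ))
  obtain ⟨hSc, hS⟩ := isNowhereDense_degenerate_values Φ.open_target hhs
    (isCompact_closedBall (Φ q) r) hrT
  set S := (fun p => (p.1, h p)) '' {p ∈ Metric.closedBall (Φ q) r |
    (fderiv ℝ h p).comp (ContinuousLinearMap.inr ℝ V K) = 0} with hSdef
  have heS : IsNowhereDense (e ⁻¹' S) := by
    rw [(hSc.preimage e.continuous).isNowhereDense_iff]
    have := e.toHomeomorph.preimage_interior S
    rw [hSc.isNowhereDense_iff.1 hS, preimage_empty] at this
    exact this.symm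
  refine ⟨Φ.source ∩ Φ ⁻¹' Metric.closedBall (Φ q) r,
    inter_mem (Φ.open_source.mem_nhds hqΦ)
      ((Φ.continuousAt hqΦ).preimage_mem_nhds (Metric.closedBall_mem_nhds _ hr)), heS.mono ?_⟩
  rintro _ ⟨z, ⟨⟨hzΦ, hzr⟩, hrank⟩, rfl⟩
  have hsz : Φ.symm (Φ z) = z := Φ.left_inv hzΦ
  have hpT : Φ z ∈ Φ.target := Φ.map_source hzΦ
  refine ⟨Φ z, ⟨hzr, ?_⟩, ?_⟩
  swap
  · change ((Φ z).1, ρ (f (Φ.symm (Φ z)))) = e (f z)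
    rw [hsz, hΦ]
    rfl
  have hM := ((hΦs.contDiffAt (Φ.open_target.mem_nhds hpT)).differentiableAt
    (by simp)).hasFDerivAt
  set M := fderiv ℝ Φ.symm (Φ z) with hMdef
  have hM1 : (π.comp (fderiv ℝ f z)).comp M = ContinuousLinearMap.fst ℝ V K := by
    have h1 : HasFDerivAt (fun p => π (f (Φ.symm p))) ((π.comp (fderiv ℝ f z)).comp M) (Φ z) := by
      have := hf1 (Φ.symm (Φ z))
      have h3 := this.comp (Φ z) hM
      rw [hsz] at h3
      exact h3
    refine h1.unique (hasFDerivAt_fst.congr_of_eventuallyEq ?_)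
    filter_upwards [Φ.open_target.mem_nhds hpT] with p hp
    have := congrArg Prod.fst (Φ.right_inv hp)
    rwa [hΦ] at this
  -- by equality of ranks, vectors tangent to the slice `π ∘ f = const` are killed by `df`
  have hker := LinearMap.ker_comp_eq_of_surjective_of_finrank_range_eq
    ((fderiv ℝ f z : E →L[ℝ] F) : E →ₗ[ℝ] F) (π : F →ₗ[ℝ] V)
    (fun v => ⟨M (v, 0), by simpa using DFunLike.congr_fun hM1 (v, (0 : K))⟩) hrank
  have hdh : fderiv ℝ h (Φ z) = (ρ.comp (fderiv ℝ f z)).comp M := by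
    have h3 := (hf2 (Φ.symm (Φ z))).comp (Φ z) hM
    rw [hsz] at h3
    exact h3.fderiv
  rw [hdh]
  ext1 k
  have hk : M (0, k) ∈ ((fderiv ℝ f z : E →L[ℝ] F) : E →ₗ[ℝ] F).ker := by
    rw [← hker]
    exact DFunLike.congr_fun hM1 ((0 : V), k)
  have hk' : fderiv ℝ f z (M (0, k)) = 0 := hk
  simp [hk']

/-- A form of Sard's theorem: the critical values of a smooth map between finite-dimensional
spaces form a meagre set. -/
theorem ContDiff.isMeagre_criticalValues {f : E → F} (hf : ContDiff ℝ ∞ f) :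
    IsMeagre (f '' {z | ¬ Function.Surjective (fderiv ℝ f z)}) := by
  set R : ℕ → Set E := fun r => {z | ¬ Function.Surjective (fderiv ℝ f z) ∧
    finrank ℝ (fderiv ℝ f z).range = r} with hR
  have hcover : {z | ¬ Function.Surjective (fderiv ℝ f z)} ⊆ ⋃ r, R r := fun z hz =>
    mem_iUnion.2 ⟨_, hz, rfl⟩
  suffices h : IsMeagre (f '' ⋃ r, R r) from h.mono (image_mono hcover)
  rw [image_iUnion]
  refine isMeagre_iUnion fun r => ?_
  have hloc : ∀ q ∈ R r, ∃ t ∈ 𝓝[R r] q, IsNowhereDense (f '' (R r ∩ t)) := by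
    rintro q ⟨hq, rfl⟩
    obtain ⟨t, ht, hn⟩ := hf.exists_nhds_isNowhereDense_image_rank_eq hq
    have hsub : R (finrank ℝ (fderiv ℝ f q).range) ∩ t ⊆ {z ∈ t |
        finrank ℝ (fderiv ℝ f z).range = finrank ℝ (fderiv ℝ f q).range} :=
      fun z hz => ⟨hz.2, hz.1.2⟩
    exact ⟨t, nhdsWithin_le_nhds ht, hn.mono (image_mono hsub)⟩
  choose! t ht hn using hloc
  obtain ⟨c, hcs, hc, hsc⟩ := TopologicalSpace.countable_cover_nhdsWithin ht
  have : f '' R r ⊆ ⋃ x ∈ c, f '' (R r ∩ t x) := by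
    rw [← image_iUnion₂, ← inter_iUnion₂]
    exact image_mono (subset_inter Subset.rfl hsc)
  exact (isMeagre_biUnion hc fun x hx => (hn x (hcs hx)).isMeagre).mono this

/-- Values that are not attained count as regular. -/
theorem ContDiff.dense_regularValues {f : E → F} (hf : ContDiff ℝ ∞ f) :
    Dense {y | ∀ z, f z = y → Function.Surjective (fderiv ℝ f z)} := by
  have : CompleteSpace F := FiniteDimensional.complete ℝ F
  refine (dense_of_mem_residual hf.isMeagre_criticalValues).mono ?_
  intro y hy z hz
  by_contra hs
  exact hy ⟨z, hs, hz⟩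

end Sard

/-! ### Preimages of regular values -/

section RegularValue

/-- Linear coordinates on `ℝ^d × K` in which the first factor becomes the last `d` coordinates. -/
theorem exists_equiv_prod_euclideanSpace {K : Type*} [NormedAddCommGroup K] [NormedSpace ℝ K]
    [FiniteDimensional ℝ K] {d n : ℕ} (hn : finrank ℝ K + d = n) :
    ∃ A : (EuclideanSpace ℝ (Fin d) × K) ≃L[ℝ] EuclideanSpace ℝ (Fin n),
      ∀ v, (∀ i : Fin n, finrank ℝ K ≤ (i : ℕ) → A v i = 0) ↔ v.1 = 0 := by
  subst hn
  set k := finrank ℝ K with hk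
  let b : K ≃ₗ[ℝ] (Fin k → ℝ) := (finBasis ℝ K).equivFun
  let A : (EuclideanSpace ℝ (Fin d) × K) ≃ₗ[ℝ] EuclideanSpace ℝ (Fin (k + d)) :=
    (LinearEquiv.prodComm ℝ _ _ ≪≫ₗ
      LinearEquiv.prodCongr b (WithLp.linearEquiv 2 ℝ (Fin d → ℝ)) ≪≫ₗ
      (LinearEquiv.sumArrowLequivProdArrow (Fin k) (Fin d) ℝ ℝ).symm ≪≫ₗ
      LinearEquiv.funCongrLeft ℝ ℝ finSumFinEquiv.symm) ≪≫ₗ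
      (WithLp.linearEquiv 2 ℝ (Fin (k + d) → ℝ)).symm
  have hA : ∀ v (j : Fin d), A v (Fin.natAdd k j) = v.1 j := by
    intro v j
    simp [A, LinearEquiv.funCongrLeft, LinearMap.funLeft]
  refine ⟨A.toContinuousLinearEquiv, fun v => ⟨fun h => ?_, fun h i hi => ?_⟩⟩
  · ext j
    rw [← hA v j]
    exact h _ (by simp)
  · obtain ⟨j, rfl⟩ : ∃ j : Fin d, i = Fin.natAdd k j :=
      ⟨⟨i - k, by omega⟩, by ext; simp; omega⟩
    exact (hA v j).trans (by simp [h])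

/-- The regular value theorem, with charts that straighten the preimage to a coordinate slice. -/
theorem isSmoothSubmanifold_preimage_of_regular {ι : Type*} [Fintype ι] {d : ℕ}
    {f : EuclideanSpace ℝ ι → EuclideanSpace ℝ (Fin d)} (hf : ContDiff ℝ ∞ f)
    {c : EuclideanSpace ℝ (Fin d)}
    (hc : ∀ z, f z = c → Function.Surjective (fderiv ℝ f z)) :
    IsSmoothSubmanifold (Fintype.card ι - d) (f ⁻¹' {c}) := by
  refine ⟨Nat.sub_le _ _, fun q hq => ?_⟩
  have hs : Function.Surjective (fderiv ℝ (fun z => f z - c) q) := by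
    rw [fderiv_sub_const]
    exact hc q hq
  obtain ⟨P, Φ, hqΦ, -, hΦ, hΦs⟩ := ContDiffOn.exists_submersion_chart isOpen_univ
    (hf.sub contDiff_const).contDiffOn (mem_univ q) hs
  have hdim : finrank ℝ (fderiv ℝ (fun z => f z - c) q).ker + d = Fintype.card ι := by
    have := LinearMap.finrank_range_add_finrank_ker
      ((fderiv ℝ (fun z => f z - c) q : EuclideanSpace ℝ ι →L[ℝ] EuclideanSpace ℝ (Fin d)) :
        EuclideanSpace ℝ ι →ₗ[ℝ] EuclideanSpace ℝ (Fin d))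
    rw [LinearMap.range_eq_top.2 hs, finrank_top, finrank_euclideanSpace_fin,
      finrank_euclideanSpace] at this
    omega
  obtain ⟨A, hA⟩ := exists_equiv_prod_euclideanSpace hdim
  rw [show finrank ℝ (fderiv ℝ (fun z => f z - c) q).ker = Fintype.card ι - d by omega] at hA
  refine ⟨Φ.transHomeomorph A.toHomeomorph, hqΦ, ?_, ?_, fun z hz => ?_⟩
  · have h1 : ContDiff ℝ ∞ fun z => A (f z - c, P z) :=
      A.contDiff.comp ((hf.sub contDiff_const).prodMk P.contDiff)
    exact h1.contDiffOn.congr fun z _ => congrArg A (hΦ z)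
  · exact hΦs.comp A.symm.contDiff.contDiffOn fun y hy => hy
  · change f z = c ↔ ∀ i : Fin (Fintype.card ι), Fintype.card ι - d ≤ (i : ℕ) → A (Φ z) i = 0
    rw [hA, hΦ, sub_eq_zero]

end RegularValue

/-! ### The network as a function of its parameters -/

section Network

/-- Smoothness jointly in the parameters and the input, which lets the induction on the layers
feed the output of one layer into the next. -/
theorem contDiff_network {σ : ℝ → ℝ} (hσ : ContDiff ℝ ∞ σ) (hs : List ℕ) : ∀ m : ℕ,
    ContDiff ℝ ∞ fun p : (ParamIdx m hs → ℝ) × (Fin m → ℝ) => network σ m hs p.1 p.2 := by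
  induction hs with
  | nil =>
    intro m
    have h1 : ∀ a : ParamIdx m [], ContDiff ℝ ∞
        fun p : (ParamIdx m [] → ℝ) × (Fin m → ℝ) => p.1 a :=
      fun a => (contDiff_apply ℝ ℝ a).comp contDiff_fst
    have h2 : ∀ j, ContDiff ℝ ∞ fun p : (ParamIdx m [] → ℝ) × (Fin m → ℝ) => p.2 j :=
      fun a => (contDiff_apply ℝ ℝ a).comp contDiff_snd
    exact (ContDiff.sum fun j _ => (h1 (Sum.inl j)).mul (h2 j)).sub (h1 (Sum.inr ()))
  | cons k hs ih =>
    intro m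
    have h1 : ∀ a : ParamIdx m (k :: hs), ContDiff ℝ ∞
        fun p : (ParamIdx m (k :: hs) → ℝ) × (Fin m → ℝ) => p.1 a :=
      fun a => (contDiff_apply ℝ ℝ a).comp contDiff_fst
    have h2 : ∀ j, ContDiff ℝ ∞ fun p : (ParamIdx m (k :: hs) → ℝ) × (Fin m → ℝ) => p.2 j :=
      fun a => (contDiff_apply ℝ ℝ a).comp contDiff_snd
    refine (ih k).comp ((contDiff_pi.2 fun i => h1 (Sum.inr i)).prodMk (contDiff_pi.2 fun i =>
      hσ.comp ((ContDiff.sum fun j _ => (h1 (Sum.inl (Sum.inl (i, j)))).mul (h2 j)).sub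
        (h1 (Sum.inl (Sum.inr i))))))

theorem IsRectified.pos {σ : ℝ → ℝ} (hσ : IsRectified σ) {t : ℝ} (ht : 0 < t) : 0 < σ t := by
  -- by continuity at `0`, the value at `t / 2` is at least `σ 0 = 0`
  have h0 : σ 0 ≤ σ (t / 2) := by
    refine le_of_tendsto
      (hσ.continuous.continuousAt.continuousWithinAt (s := Ioi 0) (x := 0)).tendsto ?_
    filter_upwards [Ioo_mem_nhdsGT (half_pos ht)] with s hs
    exact (hσ.strictMonoOn hs.1 (mem_Ioi.2 (half_pos ht)) hs.2).le
  rw [hσ.eq_zero 0 le_rfl] at h0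
  exact h0.trans_lt (hσ.strictMonoOn (mem_Ioi.2 (half_pos ht)) ht (half_lt_self ht))

/-- Neurons with thresholds just below the values `z i` have a triangular, hence invertible, matrix
of outputs. -/
theorem IsRectified.exists_thresholds {σ : ℝ → ℝ} (hσ : IsRectified σ) {d : ℕ} {z : Fin d → ℝ}
    (hz : Function.Injective z) :
    ∃ b : Fin d → ℝ, ∀ y : Fin d → ℝ, ∃ w : Fin d → ℝ, ∀ i, ∑ j, w j * σ (z i - b j) = y i := by
  have hb : ∀ j, ∃ b, b < z j ∧ ∀ i, z i < z j → z i ≤ b := by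
    intro j
    have h1 : ∀ᶠ b in 𝓝[<] (z j), ∀ i, z i < z j → z i ≤ b := by
      rw [eventually_all]
      intro i
      by_cases hi : z i < z j
      · filter_upwards [Ioo_mem_nhdsLT hi] with b hb _ using hb.1.le
      · exact Eventually.of_forall fun b h => absurd h hi
    obtain ⟨b, hb1, hb2⟩ := (h1.and self_mem_nhdsWithin).exists
    exact ⟨b, hb2, hb1⟩
  choose b hb1 hb2 using hb
  refine ⟨b, fun y => ?_⟩
  -- ordering the indices by the values `z i` makes the matrix triangular
  let o : LinearOrder (Fin d) := LinearOrder.lift' z hz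
  let A : Matrix (Fin d) (Fin d) ℝ := Matrix.of fun j i => σ (z i - b j)
  have hA : @Matrix.IsUpperTriangular (Fin d) ℝ _ o.toLT A := fun j i hij =>
    hσ.eq_zero _ (sub_nonpos.2 (hb2 j i hij))
  have hdet : IsUnit A.det := by
    rw [@Matrix.det_of_isUpperTriangular (Fin d) ℝ A _ _ _ o hA, isUnit_iff_ne_zero]
    exact Finset.prod_ne_zero_iff.2 fun i _ => (hσ.pos (sub_pos.2 (hb1 i))).ne'
  refine ⟨Matrix.vecMul y A⁻¹, fun i => ?_⟩
  have h1 : Matrix.vecMul (Matrix.vecMul y A⁻¹) A = y := by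
    rw [Matrix.vecMul_vecMul, Matrix.nonsing_inv_mul A hdet, Matrix.vecMul_one]
  exact congrFun h1 i

theorem exists_injective_dotProduct {d m : ℕ} {x : Fin d → Fin m → ℝ}
    (hx : Function.Injective x) :
    ∃ v : Fin m → ℝ, Function.Injective fun i => ∑ j, v j * x i j := by
  obtain ⟨v, hv⟩ := Module.Dual.exists_forall_ne_zero_of_forall_exists (K := ℝ)
    (M := Fin m → ℝ) (ι := {p : Fin d × Fin d // p.1 ≠ p.2})
    (fun p => Fintype.linearCombination ℝ (x p.1.1 - x p.1.2)) (fun p => by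
      obtain ⟨j, hj⟩ := Function.ne_iff.1 (hx.ne p.2)
      exact ⟨Pi.single j 1, by simpa [sub_eq_zero] using hj⟩)
  refine ⟨v, fun i i' h => ?_⟩
  by_contra hne
  refine hv ⟨(i, i'), hne⟩ ?_
  simp only [Fintype.linearCombination_apply, Pi.sub_apply, smul_eq_mul, mul_sub,
    Finset.sum_sub_distrib]
  exact sub_eq_zero.2 h

/-- A network whose last hidden layer has at least `d` neurons fits all values at `d` distinct
points: each of the preceding layers copies one and the same neuron, which separates the points. -/
theorem IsRectified.exists_network_eq {σ : ℝ → ℝ} (hσ : IsRectified σ) {d h : ℕ} (hd : d ≤ h)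
    (hs : List ℕ) (hs_pos : ∀ k ∈ hs, 0 < k) : ∀ {m : ℕ} {x : Fin d → Fin m → ℝ},
      Function.Injective x → ∀ y : Fin d → ℝ,
        ∃ θ : ParamIdx m (hs ++ [h]) → ℝ, ∀ i, network σ m (hs ++ [h]) θ (x i) = y i := by
  induction hs with
  | nil =>
    intro m x hx y
    obtain ⟨v, hv⟩ := exists_injective_dotProduct hx
    obtain ⟨b, hb⟩ := hσ.exists_thresholds hv
    obtain ⟨w, hw⟩ := hb y
    -- the neurons beyond the first `d` get output weight zero
    refine ⟨Sum.elim (Sum.elim (fun p => v p.2)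
        (fun i => if hi : (i : ℕ) < d then b ⟨i, hi⟩ else 0))
      (Sum.elim (fun i => if hi : (i : ℕ) < d then w ⟨i, hi⟩ else 0) fun _ => 0), fun i => ?_⟩
    rw [← hw i]
    change (∑ j : Fin h, (if hj : (j : ℕ) < d then w ⟨j, hj⟩ else 0) *
      σ (∑ l, v l * x i l - if hj : (j : ℕ) < d then b ⟨j, hj⟩ else 0)) - 0 = _
    rw [sub_zero]
    obtain ⟨c, rfl⟩ := Nat.exists_eq_add_of_le hd
    rw [Fin.sum_univ_add]
    simp
  | cons k hs ih =>
    intro m x hx y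
    obtain ⟨v, hv⟩ := exists_injective_dotProduct hx
    -- a threshold below all values keeps the neuron in the range where `σ` is injective
    obtain ⟨c, hc⟩ : ∃ c : ℝ, ∀ i, c < ∑ j, v j * x i j := by
      obtain ⟨c, hc⟩ := (finite_range fun i => ∑ j, v j * x i j).bddBelow
      exact ⟨c - 1, fun i => (sub_one_lt c).trans_le (hc ⟨i, rfl⟩)⟩
    have hk : 0 < k := hs_pos k (by simp)
    have hinj : Function.Injective fun (i : Fin d) (_ : Fin k) =>
        σ (∑ j, v j * x i j - c) := by
      intro i i' hii
      have h1 := hσ.strictMonoOn.injOn (mem_Ioi.2 (sub_pos.2 (hc i)))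
        (mem_Ioi.2 (sub_pos.2 (hc i'))) (congrFun hii ⟨0, hk⟩)
      exact hv (sub_left_injective h1)
    obtain ⟨θ, hθ⟩ := ih (fun k' hk' => hs_pos k' (by simp [hk'])) hinj y
    exact ⟨Sum.elim (Sum.elim (fun p => v p.2) fun _ => c) θ, hθ⟩

theorem lt_numParams_append_singleton (hs : List ℕ) (h : ℕ) : ∀ m, h < numParams m (hs ++ [h]) := by
  induction hs with
  | nil =>
    intro m
    change h < Fintype.card (((Fin h × Fin m) ⊕ Fin h) ⊕ (Fin h ⊕ Unit))
    simp only [Fintype.card_sum, Fintype.card_prod, Fintype.card_fin, Fintype.card_unit]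
    omega
  | cons k hs ih =>
    intro m
    have h1 := ih k
    have h2 : numParams m (k :: (hs ++ [h])) = Fintype.card ((Fin k × Fin m) ⊕ Fin k) +
      numParams k (hs ++ [h]) := Fintype.card_sum
    rw [List.cons_append, h2]
    omega

end Network

/-! ### Zero sets of the loss for generic data -/

theorem mainTheorem2
    (σ : ℝ → ℝ) (hσ : IsRectified σ) (hσ_smooth : ContDiff ℝ ∞ σ)
    (p d : ℕ)
    -- the widths of the hidden layers before the last one, and the width of the last one
    (hs : List ℕ) (h : ℕ) (hs_pos : ∀ k ∈ hs, 0 < k) (h_width : d < h)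
    (x : Fin d → EuclideanSpace ℝ (Fin p)) (hx : Function.Injective x)
    (y : EuclideanSpace ℝ (Fin d)) (ε : ℝ) (hε : 0 < ε) :
    d < numParams p (hs ++ [h]) ∧
    ∃ y' : EuclideanSpace ℝ (Fin d), ‖y' - y‖ < ε ∧
      IsLeast (Set.range (loss σ (hs ++ [h]) x y')) 0 ∧
      {θ | ∀ θ', loss σ (hs ++ [h]) x y' θ ≤ loss σ (hs ++ [h]) x y' θ'} =
        loss σ (hs ++ [h]) x y' ⁻¹' {0} ∧
      (loss σ (hs ++ [h]) x y' ⁻¹' {0}).Nonempty ∧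
      IsSmoothSubmanifold (numParams p (hs ++ [h]) - d) (loss σ (hs ++ [h]) x y' ⁻¹' {0}) := by
  refine ⟨h_width.trans (lt_numParams_append_singleton hs h p), ?_⟩
  -- the outputs on all data points, as a function of the parameters
  let f : EuclideanSpace ℝ (ParamIdx p (hs ++ [h])) → EuclideanSpace ℝ (Fin d) := fun θ =>
    WithLp.toLp 2 fun i => network σ p (hs ++ [h]) (fun a => θ a) (fun j => x i j)
  have hf : ContDiff ℝ ∞ f := by
    refine contDiff_euclidean.2 fun i => (contDiff_network hσ_smooth (hs ++ [h]) p).comp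
      (ContDiff.prodMk (contDiff_pi.2 fun a => ?_) contDiff_const)
    exact contDiff_euclidean.1 contDiff_id a
  obtain ⟨y', hyε, hy'⟩ := Metric.dense_iff.1 hf.dense_regularValues y ε hε
  have hloss : ∀ θ, loss σ (hs ++ [h]) x y' θ = 0 ↔ f θ = y' := by
    intro θ
    rw [loss, Finset.sum_eq_zero_iff_of_nonneg fun i _ => sq_nonneg _]
    constructor
    · intro h0
      ext i
      exact sub_eq_zero.1 (pow_eq_zero_iff two_ne_zero |>.1 (h0 i (Finset.mem_univ i)))
    · intro h0 i _
      rw [← h0]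
      exact pow_eq_zero_iff two_ne_zero |>.2 (sub_self _)
  have hnonneg : ∀ θ, 0 ≤ loss σ (hs ++ [h]) x y' θ := fun θ =>
    Finset.sum_nonneg fun i _ => sq_nonneg _
  have hpre : loss σ (hs ++ [h]) x y' ⁻¹' {0} = f ⁻¹' {y'} := Set.ext hloss
  obtain ⟨θ₀, hθ₀⟩ : ∃ θ₀, loss σ (hs ++ [h]) x y' θ₀ = 0 := by
    have hx' : Function.Injective fun (i : Fin d) (j : Fin p) => x i j := fun i i' hii =>
      hx (PiLp.ext fun j => congrFun hii j)
    obtain ⟨θ, hθ⟩ := hσ.exists_network_eq h_width.le hs hs_pos hx' y'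
    exact ⟨WithLp.toLp 2 θ, (hloss _).2 (PiLp.ext hθ)⟩
  refine ⟨y', by rwa [← dist_eq_norm], ⟨⟨θ₀, hθ₀⟩, ?_⟩, ?_, ⟨θ₀, hθ₀⟩, ?_⟩
  · rintro _ ⟨θ, rfl⟩
    exact hnonneg θ
  · ext θ
    refine ⟨fun hmin => le_antisymm ((hmin θ₀).trans_eq hθ₀) (hnonneg θ), fun h0 θ' => ?_⟩
    exact le_of_eq_of_le h0 (hnonneg θ')
  · rw [hpre]
    exact isSmoothSubmanifold_preimage_of_regular hf hy'
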